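/- For permutations $\sigma$ of length $k$ and $\pi$ of length $n$, say that $\sigma$ is contained in $\pi$, written $\sigma\le\pi$, if there are indices $i_1<\dots<i_k$ such that $\pi(i_1)\cdots\pi(i_k)$ is order isomorphic to $\sigma(1)\cdots\sigma(k)$. A permutation class is a set of finite permutations that is closed downward under containment. The inversion graph $G_\pi$ of a permutation $\pi$ of length $n$ is the graph on $\{1,\dots,n\}$ in which $i<j$ are adjacent if and only if $\pi(i)>\pi(j)$; for a set $X$ of permutations, $G_X$ is the set of all finite graphs isomorphic to $G_\pi$ for some $\pi\in X$. An interval of $\pi$ is a set of contiguous indices whose set of values under $\pi$ is also contiguous, and $\pi$ is simple if $n\ge 2$ and its only intervals are those of lengths $0$, $1$ and $n$. A set with a quasi-order $\le$ is well-quasi-ordered (wqo) if every infinite sequence $x_1,x_2,\dots$ of its elements contains a pair with $i<j$ and $x_i\le x_j$. **Proposition.** Let $\mathcal{C}$ be a permutation class such that $G_{\mathcal{C}}$ is wqo in the induced subgraph order. Then the set of simple permutations in $\mathcal{C}$ is wqo in the permutation containment order. -/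

import Mathlib

/-- A finite permutation of arbitrary length `n`, written as a bijection of `{0, …, n - 1}`. -/
abbrev FinPerm : Type := Σ n : ℕ, Equiv.Perm (Fin n)

/-- A finite graph, on the vertex set `{0, …, n - 1}`. Every finite graph is isomorphic to one of
these. -/
abbrev FinGraph : Type := Σ n : ℕ, SimpleGraph (Fin n)

namespace FinPerm

/-- The permutation containment order: `σ` is contained in `π` if some subsequence of
`π(1), …, π(n)` is order isomorphic to `σ(1), …, σ(k)`. The strictly increasing map `f` gives the
positions of that subsequence. -/
def Contained (σ π : FinPerm) : Prop :=
  ∃ f : Fin σ.1 → Fin π.1, StrictMono f ∧ ∀ i j, σ.2 i < σ.2 j ↔ π.2 (f i) < π.2 (f j)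

/-- A permutation class: a set of permutations closed downward under containment. -/
def IsClass (C : Set FinPerm) : Prop :=
  ∀ ⦃σ π : FinPerm⦄, π ∈ C → Contained σ π → σ ∈ C

/-- An interval of `π`: a contiguous set of indices whose set of values is also contiguous. -/
def IsInterval (π : FinPerm) (I : Set (Fin π.1)) : Prop :=
  I.OrdConnected ∧ (π.2 '' I).OrdConnected

/-- A permutation is simple if it has length at least two and all of its intervals are trivial,
i.e. have length `0`, `1` or `n`. -/
def IsSimple (π : FinPerm) : Prop :=
  2 ≤ π.1 ∧ ∀ I : Set (Fin π.1), IsInterval π I → I.ncard = 0 ∨ I.ncard = 1 ∨ I.ncard = π.1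

/-- The inversion graph of `π`: its vertices are the indices, and two indices are adjacent when
the corresponding entries of `π` form an inversion. -/
def inversionGraph (π : FinPerm) : SimpleGraph (Fin π.1) where
  Adj i j := (i < j ∧ π.2 j < π.2 i) ∨ (j < i ∧ π.2 i < π.2 j)
  symm := ⟨fun _ _ h => h.symm⟩
  loopless := ⟨fun i h => by rcases h with h | h <;> exact lt_irrefl i h.1⟩

/-- The graphs (up to isomorphism) that are inversion graphs of members of `X`. -/
def graphClass (X : Set FinPerm) : Set FinGraph :=
  {G | ∃ π ∈ X, Nonempty (G.2 ≃g inversionGraph π)}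

end FinPerm

/-- The induced subgraph order on finite graphs. -/
def FinGraph.InducedSubgraph (G H : FinGraph) : Prop :=
  SimpleGraph.IsIndContained G.2 H.2

/-! A simple permutation can be recovered from its inversion graph up to exchanging positions with
values and reversing both orders. Hence an induced embedding of the graph of a simple permutation
into another inversion graph is a containment up to one of four twists (`exists_twistedContained`).
The twists form the group (ℤ/2)², so along an infinite chain of graph embeddings two partial
products agree, and between those two places the twist cancels.

Recovery rests on `orientation_unique`. Colour each pair by whether it is a non-inversion, an
inversion on which the two position orders agree, or one on which they disagree. No triangle is
rainbow, so by Gallai some colour is disconnected. Its components are convex in both orders, hence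
intervals, so if all three colours occur, simplicity is violated. -/

/-! ### Rainbow-free colourings and Gallai's theorem -/

/-- `y` can be reached from `x` inside `W` along pairs of colour `c`. -/
def ColorReach {V γ : Type*} (col : V → V → γ) (W : Set V) (c : γ) : V → V → Prop :=
  Relation.ReflTransGen fun x y => x ∈ W ∧ y ∈ W ∧ col x y = c

/-- The edge colouring `col` has no triangle with three distinct colours. -/
def NoRainbow {V γ : Type*} (col : V → V → γ) : Prop :=
  ∀ x y z, col x y = col y z ∨ col y z = col x z ∨ col x y = col x z

namespace ColorReach

variable {V γ : Type*} {col : V → V → γ} {W : Set V} {c : γ}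

theorem symm (hs : ∀ x y, col x y = col y x) {x y : V} (h : ColorReach col W c x y) :
    ColorReach col W c y x := by
  induction h with
  | refl => exact .refl
  | tail _ hbc ih => exact .head ⟨hbc.2.1, hbc.1, by rw [hs, hbc.2.2]⟩ ih

theorem mem {x y : V} (hx : x ∈ W) (h : ColorReach col W c x y) : y ∈ W := by
  induction h with
  | refl => exact hx
  | tail _ hbc _ => exact hbc.2.1

/-- A vertex outside a colour component sees the whole component in a single colour. -/
theorem col_eq (hs : ∀ x y, col x y = col y x) (hr : NoRainbow col) {u u' x : V}
    (hx : x ∈ W) (h : ColorReach col W c u u') (hn : ¬ ColorReach col W c u x) :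
    col x u' = col x u := by
  induction h with
  | refl => rfl
  | @tail b d hb hbd ih =>
    have h1 : col x b ≠ c := fun hc => hn (hb.tail ⟨hbd.1, hx, by rw [hs, hc]⟩)
    have h2 : col x d ≠ c := fun hc => hn ((hb.tail hbd).tail ⟨hbd.2.1, hx, by rw [hs, hc]⟩)
    rw [← ih]
    rcases hr x b d with h | h | h
    · exact absurd (h.trans hbd.2.2) h1
    · exact absurd (h.symm.trans hbd.2.2) h2
    · exact h.symm

/-- A path ending in `v` passes through a neighbour of `v` before it first meets `v`. -/
theorem exists_adj {u v : V} (huv : u ≠ v) (h : ColorReach col W c u v) :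
    ∃ w, w ≠ v ∧ w ∈ W ∧ ColorReach col (W \ {v}) c u w ∧ col w v = c := by
  induction h using Relation.ReflTransGen.head_induction_on with
  | refl => exact absurd rfl huv
  | @head a b hab _ ih =>
    by_cases hb : b = v
    · subst hb
      exact ⟨a, huv, hab.1, .refl, hab.2.2⟩
    · obtain ⟨w, h1, h2, h3, h4⟩ := ih hb
      exact ⟨w, h1, h2, .head ⟨⟨hab.1, huv⟩, ⟨hab.2.1, hb⟩, hab.2.2⟩ h3, h4⟩

end ColorReach

/-- Gallai: if three colours are used without a rainbow triangle, then some colour is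
disconnected. -/
theorem NoRainbow.exists_not_colorReach {V : Type*} [DecidableEq V] {col : V → V → Fin 3}
    (hs : ∀ x y, col x y = col y x) (hr : NoRainbow col) (W : Finset V) (hW : 2 ≤ W.card) :
    ∃ c, ∃ x ∈ W, ∃ y ∈ W, ¬ ColorReach col (W : Set V) c x y := by
  induction W using Finset.strongInduction with
  | H W ih =>
    by_contra! hcon
    obtain ⟨v, hv⟩ : W.Nonempty := Finset.card_pos.mp (by omega)
    have hcard : (W.erase v).card = W.card - 1 := Finset.card_erase_of_mem hv
    have hset : ((W.erase v : Finset V) : Set V) = (W : Set V) \ {v} := by simp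
    have hexit : ∀ c, ∀ u ∈ W.erase v, ∃ w ∈ W.erase v,
        ColorReach col (W.erase v : Finset V) c u w ∧ col v w = c := by
      intro c u hu
      rw [Finset.mem_erase] at hu
      obtain ⟨w, h1, h2, h3, h4⟩ := (hcon c u hu.2 v hv).exists_adj hu.1
      exact ⟨w, Finset.mem_erase.mpr ⟨h1, h2⟩, by rwa [hset], by rw [hs, h4]⟩
    obtain ⟨u₀, hu₀⟩ : (W.erase v).Nonempty := Finset.card_pos.mp (by omega)
    by_cases h2 : 2 ≤ (W.erase v).card
    · obtain ⟨c, p, hp, q, hq, hpq⟩ := ih _ (Finset.erase_ssubset hv) h2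
      obtain ⟨a, b, hca, hcb, hab⟩ : ∃ a b : Fin 3, c ≠ a ∧ c ≠ b ∧ a ≠ b := by
        clear hpq
        revert c
        decide
      generalize W.erase v = W' at *
      -- An edge between distinct `c`-components does not have colour `c`, so in a triangle with `v`
      -- it must copy the other edge at `v`.
      have third : ∀ {w z e}, w ∈ W' → z ∈ W' → ¬ ColorReach col (W' : Set V) c w z →
          col v w = c → col v z = e → c ≠ e → col w z = e := by
        intro w z e hw hz hn h1 h2 h3
        have : col w z ≠ c := fun h => hn (.single ⟨hw, hz, h⟩)
        rcases hr v w z with h | h | h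
        · exact absurd (h.symm.trans h1) this
        · exact h.trans h2
        · exact absurd (h1.symm.trans (h.trans h2)) h3
      obtain ⟨u, hu, -, hua⟩ := hexit a u₀ hu₀
      obtain ⟨u', hu', -, hub⟩ := hexit b u₀ hu₀
      -- If `u` and `u'` share a `c`-component, a vertex `w` outside it sees `u` in colour `a` and
      -- `u'` in colour `b`, against `col_eq`. Otherwise the edge between their components is forced
      -- to have both colours.
      by_cases huu : ColorReach col (W' : Set V) c u u'
      · obtain ⟨q', hq', hn⟩ : ∃ q' ∈ W', ¬ ColorReach col (W' : Set V) c u q' := by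
          by_contra! h
          exact hpq (((h p hp).symm hs).trans (h q hq))
        obtain ⟨w, hw, hqw, hvw⟩ := hexit c q' hq'
        have hnw : ¬ ColorReach col (W' : Set V) c u w := fun h => hn (h.trans (hqw.symm hs))
        have e1 := third hw hu (fun h => hnw (h.symm hs)) hvw hua hca
        have e2 := third hw hu' (fun h => hnw (huu.trans (h.symm hs))) hvw hub hcb
        exact hab (e1.symm.trans ((huu.col_eq hs hr hw hnw).symm.trans e2))
      · obtain ⟨w, hw, huw, hvw⟩ := hexit c u' hu'
        obtain ⟨w', hw', huw', hvw'⟩ := hexit c u hu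
        have e1 := third hw hu (fun h => huu (ColorReach.symm hs (huw.trans h))) hvw hua hca
        have e2 := third hw' hu' (fun h => huu (huw'.trans h)) hvw' hub hcb
        have e3 := huw.col_eq hs hr hu (fun h => huu (h.symm hs))
        have e4 := huw'.col_eq hs hr hu' huu
        rw [hs u w, e1] at e3
        rw [hs u' w', e2, hs u' u] at e4
        exact hab (e3.trans e4.symm)
    -- Two vertices span a single edge, which cannot connect them in two colours.
    · have h1 : (W.erase v).card = 1 := by omega
      obtain ⟨u, hu⟩ := Finset.card_eq_one.mp h1
      rw [hu] at hexit
      obtain ⟨w, hw, -, h0⟩ := hexit 0 u (by simp)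
      obtain ⟨w', hw', -, h1⟩ := hexit 1 u (by simp)
      rw [Finset.mem_singleton] at hw hw'
      subst hw hw'
      exact absurd (h0.symm.trans h1) (by decide)

/-! ### Uniqueness of the orientation -/

/-- `K` is an interval in the order pulled back along `f`. -/
def ConvexAlong {V : Type*} (f : V → ℤ) (K : Set V) : Prop :=
  ∀ x ∈ K, ∀ y ∈ K, ∀ v, f x < f v → f v < f y → v ∈ K

theorem ConvexAlong.neg {V : Type*} {f : V → ℤ} {K : Set V} (h : ConvexAlong (-f) K) :
    ConvexAlong f K := by
  intro x hx y hy v h1 h2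
  exact h y hy x hx v (by simpa using h2) (by simpa using h1)

/-- A colour component is convex in every order on which all colours are transitive. -/
theorem ColorReach.convexAlong {V γ : Type*} {col : V → V → γ} (hs : ∀ x y, col x y = col y x)
    (hr : NoRainbow col) {f : V → ℤ} (hf : Function.Injective f)
    (ht : ∀ x y z, f x < f y → f y < f z → col x y = col y z → col x z = col x y)
    (c : γ) (p : V) : ConvexAlong f {z | ColorReach col Set.univ c p z} := by
  intro x hx y hy v hxv hvy
  by_contra hv
  -- A path in the component cannot jump over `v`: if an edge `b d` did, `v` would see both ends in
  -- one colour, and transitivity would make that colour `c`.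
  have key : ∀ z, ColorReach col Set.univ c x z → f z < f v := by
    intro z hz
    induction hz with
    | refl => exact hxv
    | @tail b d hb hbd ih =>
      by_contra hdv
      have hvne : v ≠ d := fun h => hv (h ▸ (Relation.ReflTransGen.trans hx hb).tail hbd)
      have hlt : f v < f d := lt_of_le_of_ne (not_lt.mp hdv) (hf.ne hvne)
      have hnb : ¬ ColorReach col Set.univ c b v :=
        fun h => hv ((Relation.ReflTransGen.trans hx hb).trans h)
      have e : col v d = col v b :=
        ColorReach.col_eq hs hr (Set.mem_univ _) (Relation.ReflTransGen.single hbd) hnb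
      have e2 := ht b v d ih hlt (by rw [e, hs])
      exact hnb (Relation.ReflTransGen.single ⟨trivial, trivial, by rw [← e2, hbd.2.2]⟩)
  exact absurd (key y (((show ColorReach col _ c p x from hx).symm hs).trans hy)) (by omega)

/-- Two pairs of linear orders with the same inversions, the first pair being simple: on the
inversions, the two first orders agree everywhere or disagree everywhere. -/
theorem orientation_unique {V : Type*} [Finite V] {f₁ f₂ g₁ g₂ : V → ℤ}
    (hf₁ : Function.Injective f₁) (hf₂ : Function.Injective f₂)
    (hg₁ : Function.Injective g₁) (hg₂ : Function.Injective g₂)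
    (hfg : ∀ x y, (f₁ x < f₁ y ↔ f₂ x < f₂ y) ↔ (g₁ x < g₁ y ↔ g₂ x < g₂ y))
    (hsimple : ∀ K : Set V, ConvexAlong f₁ K → ConvexAlong f₂ K → K.Subsingleton ∨ K = Set.univ) :
    (∀ x y, ¬ (f₁ x < f₁ y ↔ f₂ x < f₂ y) → (f₁ x < f₁ y ↔ g₁ x < g₁ y)) ∨
    (∀ x y, ¬ (f₁ x < f₁ y ↔ f₂ x < f₂ y) → (f₁ x < f₁ y ↔ g₁ y < g₁ x)) := by
  classical
  by_contra! hcon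
  obtain ⟨⟨a, b, hab, hab'⟩, ⟨a', b', hab₁, hab₁'⟩⟩ := hcon
  have _ := Fintype.ofFinite V
  -- Colour 0 marks non-inversions (and the diagonal); 1 and 2 mark inversions on which `f₁` and
  -- `g₁` agree or disagree.
  let col : V → V → Fin 3 := fun x y =>
    if (f₁ x < f₁ y ↔ f₂ x < f₂ y) then 0 else if (f₁ x < f₁ y ↔ g₁ x < g₁ y) then 1 else 2
  have inj : ∀ x y, x = y ∨ (f₁ x ≠ f₁ y ∧ f₂ x ≠ f₂ y ∧ g₁ x ≠ g₁ y ∧ g₂ x ≠ g₂ y) := by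
    intro x y
    by_cases h : x = y
    · exact .inl h
    · exact .inr ⟨hf₁.ne h, hf₂.ne h, hg₁.ne h, hg₂.ne h⟩
  have hs : ∀ x y, col x y = col y x := by
    intro x y
    rcases inj x y with rfl | h
    · rfl
    · simp only [col]
      grind
  -- If `x y` and `y z` are inversions and `x z` is not, then `y` is above both or below both, in
  -- `f₁` and likewise in `g₁`; so both inversions get the same colour.
  have hr : NoRainbow col := by
    intro x y z
    have h1 := hfg x y
    have h2 := hfg y z
    have h3 := hfg x z
    rcases inj x y with rfl | i1
    · simp
    rcases inj y z with rfl | i2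
    · simp
    rcases inj x z with rfl | i3
    · exact .inl (hs _ _)
    simp only [col]
    grind
  have ht₁ : ∀ x y z, f₁ x < f₁ y → f₁ y < f₁ z → col x y = col y z → col x z = col x y := by
    intro x y z h1 h2
    have h3 := inj x y
    have h4 := inj y z
    have h5 := inj x z
    simp only [col]
    grind
  have ht₂ : ∀ x y z, f₂ x < f₂ y → f₂ y < f₂ z → col x y = col y z → col x z = col x y := by
    intro x y z h1 h2
    have h3 := inj x y
    have h4 := inj y z
    have h5 := inj x z
    simp only [col]
    grind
  have c₂ : col a b = 2 := by simp only [col]; grind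
  have c₁ : col a' b' = 1 := by
    have := inj a' b'
    simp only [col]; grind
  by_cases h0 : ∃ x y, x ≠ y ∧ col x y = 0
  · have used : ∀ c, ∃ x y, x ≠ y ∧ col x y = c := by
      intro c
      fin_cases c
      · exact h0
      · exact ⟨a', b', by rintro rfl; simp at hab₁, c₁⟩
      · exact ⟨a, b, by rintro rfl; simp at hab, c₂⟩
    have hne : a ≠ b := by rintro rfl; simp at hab
    obtain ⟨c, x, -, y, -, hxy⟩ := hr.exists_not_colorReach hs Finset.univ
      (Finset.one_lt_card.mpr ⟨a, Finset.mem_univ _, b, Finset.mem_univ _, hne⟩)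
    rw [Finset.coe_univ] at hxy
    -- The component of an endpoint of a `c`-edge is neither a point nor everything.
    obtain ⟨p, q, hpq, hc⟩ := used c
    rcases hsimple _ (ColorReach.convexAlong hs hr hf₁ ht₁ c p)
      (ColorReach.convexAlong hs hr hf₂ ht₂ c p) with h | h
    · exact hpq (h (show ColorReach col _ c p p from .refl)
        (show ColorReach col _ c p q from .single ⟨trivial, trivial, hc⟩))
    · have hx : ColorReach col Set.univ c p x := h.symm.subset (Set.mem_univ x)
      have hy : ColorReach col Set.univ c p y := h.symm.subset (Set.mem_univ y)
      exact hxy ((hx.symm hs).trans hy)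
  -- Without colour 0 the order `f₂` is `f₁` reversed, so deleting the minimum of `f₁` leaves an
  -- interval. Simplicity then allows at most two points, hence one edge, which would have colours 1
  -- and 2.
  · have hrev : ∀ x y, f₁ x < f₁ y → f₂ y < f₂ x := by
      intro x y hxy
      rcases inj x y with rfl | h
      · omega
      by_contra hle
      refine h0 ⟨x, y, by rintro rfl; omega, ?_⟩
      simp only [col]
      grind
    obtain ⟨m, hm⟩ := @Finite.exists_min V ℤ _ ⟨a⟩ _ f₁
    have hm' : ∀ x, x ≠ m → f₁ m < f₁ x := fun x hx => lt_of_le_of_ne (hm x) (hf₁.ne hx.symm)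
    rcases hsimple {m}ᶜ
      (by
        rintro x hx y hy v h1 h2 rfl
        exact absurd (hm x) (by omega))
      (by
        rintro x hx y hy v h1 h2 rfl
        exact absurd (hrev _ _ (hm' y hy)) (by omega)) with h | h
    · have hK : ∀ x y, x ≠ m → y ≠ m → x = y := fun x y hx hy => h hx hy
      have hne : a ≠ b := by rintro rfl; simp at hab
      have hne' : a' ≠ b' := by rintro rfl; simp at hab₁
      have hsab := hs a b
      have key : ∀ x y, x ≠ y → x = m ∨ y = m := by
        intro x y hxy
        by_contra! hm
        exact hxy (hK x y hm.1 hm.2)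
      clear_value col
      rcases key a b hne with rfl | rfl <;> rcases key a' b' hne' with rfl | rfl
      · rw [hK b b' hne.symm hne'.symm, c₁] at c₂
        exact absurd c₂ (by decide)
      · rw [hsab, hK b a' hne.symm hne', c₁] at c₂
        exact absurd c₂ (by decide)
      · rw [hsab, hK a b' hne hne'.symm, c₁] at c₂
        exact absurd c₂ (by decide)
      · rw [hK a a' hne hne', c₁] at c₂
        exact absurd c₂ (by decide)
    · exact absurd (h.symm ▸ Set.mem_univ m : m ∈ ({m}ᶜ : Set V)) (by simp)

/-! ### Twisted containment of permutations -/

namespace FinPerm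

/-- The order of positions of `π` for `b = false`, the order of values for `b = true`. -/
def coord (π : FinPerm) (b : Bool) (x : Fin π.1) : ℤ :=
  if b then (π.2 x : ℤ) else (x : ℤ)

/-- The order by coordinate `b`, reversed if `r` is true. -/
def coordLT (π : FinPerm) (b r : Bool) (x y : Fin π.1) : Prop :=
  if r then π.coord b y < π.coord b x else π.coord b x < π.coord b y

/-- `σ` embeds in `ρ` after exchanging positions and values (if `s`) and reversing both orders
(if `r`). -/
def TwistedContained (s r : Bool) (σ ρ : FinPerm) : Prop :=
  ∃ h : Fin σ.1 → Fin ρ.1,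
    ∀ b x y, ρ.coord b (h x) < ρ.coord b (h y) ↔ σ.coordLT (xor b s) r x y

theorem TwistedContained.refl (σ : FinPerm) : TwistedContained false false σ σ :=
  ⟨id, by simp [coordLT]⟩

/-- The exchange and the double reversal are commuting involutions, so twists add in (ℤ/2)². -/
theorem TwistedContained.trans {s r s' r' : Bool} {σ ρ τ : FinPerm}
    (h : TwistedContained s r σ ρ) (h' : TwistedContained s' r' ρ τ) :
    TwistedContained (xor s s') (xor r r') σ τ := by
  obtain ⟨f, hf⟩ := h
  obtain ⟨g, hg⟩ := h'
  refine ⟨g ∘ f, fun b x y => ?_⟩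
  have e : xor b (xor s s') = xor (xor b s') s := by cases b <;> cases s <;> cases s' <;> rfl
  rw [Function.comp, Function.comp, hg, e]
  cases r' <;> simp only [coordLT, Bool.false_eq_true, if_true, if_false, hf] <;>
    cases r <;> simp

theorem TwistedContained.contained {σ ρ : FinPerm} (h : TwistedContained false false σ ρ) :
    Contained σ ρ := by
  obtain ⟨f, hf⟩ := h
  refine ⟨f, fun x y hxy => ?_, fun x y => ?_⟩
  · simpa [coordLT, coord, hxy] using hf false x y
  · simpa [coordLT, coord] using (hf true x y).symm

theorem coord_injective (π : FinPerm) (b : Bool) : Function.Injective (π.coord b) := by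
  intro x y h
  cases b <;> simpa [coord, Fin.val_inj] using h

theorem IsSimple.subsingleton_or_eq_univ {π : FinPerm} (hπ : π.IsSimple) (K : Set (Fin π.1))
    (h₁ : ConvexAlong (π.coord false) K) (h₂ : ConvexAlong (π.coord true) K) :
    K.Subsingleton ∨ K = Set.univ := by
  have hI : IsInterval π K := by
    constructor
    · refine ⟨fun x hx y hy v hv => ?_⟩
      rcases hv.1.eq_or_lt with rfl | h1
      · exact hx
      rcases hv.2.eq_or_lt with rfl | h2
      · exact hy
      exact h₁ x hx y hy v (by simpa [coord] using h1) (by simpa [coord] using h2)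
    · refine ⟨?_⟩
      rintro _ ⟨x, hx, rfl⟩ _ ⟨y, hy, rfl⟩ v hv
      obtain ⟨v, rfl⟩ := π.2.surjective v
      refine ⟨v, ?_, rfl⟩
      rcases hv.1.eq_or_lt with h | h1
      · exact π.2.injective h ▸ hx
      rcases hv.2.eq_or_lt with h | h2
      · exact π.2.injective h ▸ hy
      exact h₂ x hx y hy v (by simpa [coord] using h1) (by simpa [coord] using h2)
  rcases hπ.2 K hI with h | h | h
  · rw [Set.ncard_eq_zero] at h
    simp [h]
  · obtain ⟨a, rfl⟩ := Set.ncard_eq_one.mp h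
    simp
  · right
    exact Set.eq_of_subset_of_ncard_le (Set.subset_univ _) (by simp [Set.ncard_univ, h])

theorem not_inversionGraph_adj_iff (π : FinPerm) (x y : Fin π.1) :
    ¬ (inversionGraph π).Adj x y ↔
      (π.coord false x < π.coord false y ↔ π.coord true x < π.coord true y) := by
  have h : x = y ∨ (x ≠ y ∧ π.2 x ≠ π.2 y) := by
    by_cases h : x = y
    · exact .inl h
    · exact .inr ⟨h, π.2.injective.ne h⟩
  rcases h with rfl | h
  · simp
  · simp only [inversionGraph, coord, Bool.false_eq_true, if_true, if_false, Nat.cast_lt,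
      Fin.val_fin_lt]
    grind

/-- Embeddings between inversion graphs are induced by twisted containments if the smaller
permutation is simple. -/
theorem IsSimple.exists_twistedContained {π ρ : FinPerm} (hπ : π.IsSimple)
    (h : (inversionGraph π).IsIndContained (inversionGraph ρ)) :
    ∃ s r, TwistedContained s r π ρ := by
  obtain ⟨φ⟩ := h
  have hg : ∀ b, Function.Injective fun x => ρ.coord b (φ x) :=
    fun b => (ρ.coord_injective b).comp φ.injective
  have hfg : ∀ x y, (π.coord false x < π.coord false y ↔ π.coord true x < π.coord true y) ↔
      (ρ.coord false (φ x) < ρ.coord false (φ y) ↔ ρ.coord true (φ x) < ρ.coord true (φ y)) := by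
    intro x y
    rw [← not_inversionGraph_adj_iff, ← not_inversionGraph_adj_iff, φ.map_adj_iff]
  have inj : ∀ x y, x = y ∨ (∀ b, π.coord b x ≠ π.coord b y ∧
      ρ.coord b (φ x) ≠ ρ.coord b (φ y)) := by
    intro x y
    by_cases h : x = y
    · exact .inl h
    · exact .inr fun b => ⟨(π.coord_injective b).ne h, (hg b).ne h⟩
  have hedge := orientation_unique (π.coord_injective false) (π.coord_injective true) (hg false)
    (hg true) hfg hπ.subsingleton_or_eq_univ
  -- Negating the second orders swaps inversions with non-inversions and preserves intervals.
  have hnonedge := orientation_unique (f₂ := -π.coord true) (g₂ := -fun x => ρ.coord true (φ x))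
    (π.coord_injective false) (neg_injective.comp (π.coord_injective true)) (hg false)
    (neg_injective.comp (hg true))
    (by
      intro x y
      have h1 := hfg x y
      simp only [Pi.neg_apply, neg_lt_neg_iff]
      rcases inj x y with rfl | h
      · simp
      · have h2 := h true
        grind)
    (fun K h₁ h₂ => hπ.subsingleton_or_eq_univ K h₁ h₂.neg)
  simp only [Pi.neg_apply, neg_lt_neg_iff] at hnonedge
  -- The two value orders are the position orders reversed exactly on inversions. So reversing the
  -- position order on non-inversions only gives the reversed value order, and on inversions only
  -- gives the value order.
  rcases hedge with he | he <;> rcases hnonedge with hn | hn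
  · refine ⟨false, false, φ, fun b x y => ?_⟩
    have h1 := hfg x y
    have h2 := he x y
    have h3 := hn x y
    rcases inj x y with rfl | h
    · simp [coordLT]
    · have h4 := h false
      have h5 := h true
      cases b <;> simp only [coordLT, Bool.xor_false, Bool.false_eq_true, if_false] <;> omega
  · refine ⟨true, true, φ, fun b x y => ?_⟩
    have h1 := hfg x y
    have h2 := he x y
    have h3 := hn x y
    rcases inj x y with rfl | h
    · simp [coordLT]
    · have h4 := h false
      have h5 := h true
      cases b <;> simp only [coordLT, Bool.xor_true, Bool.not_true, Bool.not_false, if_true] <;>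
        omega
  · refine ⟨true, false, φ, fun b x y => ?_⟩
    have h1 := hfg x y
    have h2 := he x y
    have h3 := hn x y
    rcases inj x y with rfl | h
    · simp [coordLT]
    · have h4 := h false
      have h5 := h true
      cases b <;> simp only [coordLT, Bool.xor_true, Bool.not_true, Bool.not_false,
        Bool.false_eq_true, if_false] <;> omega
  · refine ⟨false, true, φ, fun b x y => ?_⟩
    have h1 := hfg x y
    have h2 := he x y
    have h3 := hn x y
    rcases inj x y with rfl | h
    · simp [coordLT]
    · have h4 := h false
      have h5 := h true
      cases b <;> simp only [coordLT, Bool.xor_false, if_true] <;> omega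

/-- Along a chain of twisted containments, two members are related without a twist. -/
theorem exists_contained_of_twisted_chain (π : ℕ → FinPerm)
    (h : ∀ n, ∃ s r, TwistedContained s r (π n) (π (n + 1))) :
    ∃ m n, m < n ∧ Contained (π m) (π n) := by
  choose s r hsr using h
  -- Accumulated twist from the start of the chain; its four possible values allow the pigeonhole.
  let p : ℕ → Bool × Bool :=
    fun n => n.rec (false, false) fun k q => (xor q.1 (s k), xor q.2 (r k))
  have hp : ∀ m k, TwistedContained (xor (p m).1 (p (m + k)).1) (xor (p m).2 (p (m + k)).2)
      (π m) (π (m + k)) := by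
    intro m k
    induction k with
    | zero => simpa using TwistedContained.refl (π m)
    | succ k ih =>
      have := ih.trans (hsr (m + k))
      rw [Bool.xor_assoc, Bool.xor_assoc] at this
      exact this
  have main : ∀ m n, m < n → p m = p n → Contained (π m) (π n) := by
    intro m n hmn he
    have := hp m (n - m)
    rw [Nat.add_sub_of_le hmn.le, he, Bool.xor_self, Bool.xor_self] at this
    exact this.contained
  obtain ⟨m, n, hne, he⟩ := Finite.exists_ne_map_eq_of_infinite p
  rcases hne.lt_or_gt with h | h
  · exact ⟨m, n, h, main m n h he⟩
  · exact ⟨n, m, h, main n m h he.symm⟩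

end FinPerm

theorem mainTheorem12 (C : Set FinPerm) (hC : FinPerm.IsClass C)
    (hG : (FinPerm.graphClass C).PartiallyWellOrderedOn FinGraph.InducedSubgraph) :
    {σ : FinPerm | σ ∈ C ∧ FinPerm.IsSimple σ}.PartiallyWellOrderedOn FinPerm.Contained := by
  have : IsPreorder FinGraph FinGraph.InducedSubgraph :=
    { refl := fun G => SimpleGraph.IsIndContained.refl G.2
      trans := fun _ _ _ h h' => SimpleGraph.IsIndContained.trans h h' }
  rw [Set.partiallyWellOrderedOn_iff_exists_lt]
  intro π hπ
  obtain ⟨g, hg⟩ := hG.exists_monotone_subseq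
    (f := fun n => (⟨(π n).1, FinPerm.inversionGraph (π n)⟩ : FinGraph))
    (fun n => ⟨π n, (hπ n).1, ⟨SimpleGraph.Iso.refl⟩⟩)
  obtain ⟨m, n, hmn, h⟩ := FinPerm.exists_contained_of_twisted_chain (fun n => π (g n))
    fun n => (hπ (g n)).2.exists_twistedContained (hg n (n + 1) n.le_succ)
  exact ⟨g m, g n, g.strictMono hmn, h⟩
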